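/- Let $\mathbf{Unif}$ be the category of all (not necessarily separated) uniform spaces and uniformly continuous maps. Subcategories are full and isomorphism closed, and are identified with the classes of their objects. Closed under products means: closed under products of arbitrary small (possibly empty) families, formed in $\mathbf{Unif}$. Closed under closed subspaces means: if $D\to C$ is a uniform embedding with closed image and $C\in\mathcal C$, then $D\in\mathcal C$ (the empty subspace included). A subcategory $\mathcal C$ with underlying set functor $U:\mathcal C\to\mathbf{Set}$ is called algebraic if $\mathcal C$ has coequalizers, $U$ has a left adjoint, and $U$ preserves and reflects regular epimorphisms. A uniform space $X$ is indiscrete if $X\times X$ is its only entourage. A subcategory of a category $\mathcal K$ is epireflective in $\mathcal K$ if it is reflective in $\mathcal K$ and all reflection maps are epimorphisms of $\mathcal K$. Theorem 5. Let $\mathcal C$ be a subcategory of $\mathbf{Unif}$. Then the following are equivalent: 1) $\mathcal C$ is closed under products, is closed under closed subspaces, and is algebraic. 2) Either $\mathcal C$ is the class of all indiscrete uniform spaces, or $\mathcal C$ is an epireflective subcategory of the category of compact $T_2$ uniform spaces. None of the three properties in 1) can be omitted without invalidating the implication $1)\Rightarrow 2)$: for each of the three properties there is a subcategory of $\mathbf{Unif}$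 that has the other two properties but does not satisfy 2). -/

import Mathlib

open CategoryTheory

universe u v w

/-- A concrete category with underlying set functor `U` is algebraic if it has coequalizers,
`U` has a left adjoint, and `U` preserves and reflects regular epimorphisms. -/
structure IsAlgebraicCategory {C : Type v} [Category.{w} C] (U : C ⥤ Type u) [U.Faithful] : Prop where
  hasCoequalizers : Limits.HasCoequalizers C
  isRightAdjoint : U.IsRightAdjoint
  preserves_regularEpi : ∀ {X Y : C} (f : X ⟶ Y), IsRegularEpi f → IsRegularEpi (U.map f)
  reflects_regularEpi : ∀ {X Y : C} (f : X ⟶ Y), IsRegularEpi (U.map f) → IsRegularEpi f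

/-- A full subcategory is epireflective if it is reflective and every reflection map
(unit of the adjunction) is an epimorphism of the ambient category. -/
def IsEpireflective {C : Type v} [Category.{w} C] (Q : ObjectProperty C) : Prop :=
  ∃ _ : Reflective Q.ι, ∀ X : C, Epi ((reflectorAdjunction Q.ι).unit.app X)

/-- `P` is an epireflective subcategory of the full subcategory `K`: it is contained in `K`, and
is epireflective in `K`, the epimorphisms being those of the category `K`. -/
def IsEpireflectiveIn {C : Type v} [Category.{w} C] (P K : ObjectProperty C) : Prop :=
  P ≤ K ∧ IsEpireflective (P.inverseImage K.ι)

namespace UniformSubcategory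

/-- The underlying set functor of the full subcategory of uniform spaces satisfying `P`. -/
abbrev underlying (P : ObjectProperty UniformSpaceCat.{u}) : P.FullSubcategory ⥤ Type u :=
  P.ι ⋙ forget UniformSpaceCat.{u}

/-- Products are formed in the category of all uniform spaces; the (small) family may be empty. -/
def ClosedUnderProducts (P : ObjectProperty UniformSpaceCat.{u}) : Prop :=
  ∀ (J : Type u) (X : J → UniformSpaceCat.{u}), (∀ j, P (X j)) →
    P (UniformSpaceCat.of (∀ j, X j))

/-- If `m : D ⟶ C` is an embedding of uniform spaces with closed image and `C` satisfies `P`,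
so does `D`. -/
def ClosedUnderClosedSubspaces (P : ObjectProperty UniformSpaceCat.{u}) : Prop :=
  ∀ {D C : UniformSpaceCat.{u}} (m : D ⟶ C), IsUniformEmbedding (m : D → C) →
    IsClosed (Set.range (m : D → C)) → P C → P D

/-- Indiscrete uniform spaces: the only entourage is the whole square. -/
def indiscrete : ObjectProperty UniformSpaceCat.{u} :=
  fun X => uniformity X = ⊤

/-- Compact Hausdorff uniform spaces. -/
def compactT2 : ObjectProperty UniformSpaceCat.{u} :=
  fun X => CompactSpace X ∧ T2Space X

end UniformSubcategory

/-!
Let `P` be closed under products and closed subspaces and algebraic. Reflection of regular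
epimorphisms says that surjective morphisms of `P` are regular epimorphisms, hence final: a
morphism which is constant on the fibres of a surjective morphism `h` factors through `h` by a
uniformly continuous map (`exists_uniformContinuous_factor`).
The description of `P` is obtained by applying this to suitable surjections.

* If some `X` in `P` is not compact but Hausdorff, it contains a chain of nonempty closed sets `D i`
  with empty intersection. Pairs of a lower set `b` of indices and a point of `⋂ i ∈ b, D i` form a
  closed subspace of a power of `X`, whose projection hits exactly the proper lower sets. Adding a
  disjoint copy of `X` over the greatest lower set gives a surjection which is not final, since the
  greatest lower set is a limit of proper ones (`compactSpace_of_isAlgebraicCategory`). So, if `P`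
  has only separated members, it consists of compact Hausdorff spaces. The reflection of a compact
  space is then its image in a product indexed by kernels (`exists_universal_quotient`).
* If some member of `P` is not separated, the closure of a point provides an indiscrete space with
  two points. A bijection between products shows that all members of `P` are indiscrete
  (`le_indiscrete_of_nontrivial`), and coequalizers provide all indiscrete spaces
  (`indiscrete_le_of_nontrivial`).

Conversely, epimorphisms of compact Hausdorff spaces are surjective, so that the reflection of a
compact Hausdorff space whose points are separated by morphisms to `P` is an isomorphism; this gives
both closure properties. Algebraicity follows from an elementary criterion
(`isAlgebraicCategory_of_elementary`), with quotients and free objects given by universal quotients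
of compact spaces, in the latter case of the Stone–Čech compactification of a discrete space.

The discrete uniform spaces, the one-point spaces and all uniform spaces show that none of the
three properties can be omitted.
-/

/-! ### Universal arrows and coequalizers -/

section Categorical

variable {C : Type*} {D : Type*} [Category* C] [Category* D]

/-- A functor with a universal arrow from every object has a left adjoint, whose unit may be taken
to consist of the given universal arrows. -/
theorem exists_adjunction_of_universal_arrows (G : D ⥤ C) (F : C → D) (η : ∀ X, X ⟶ G.obj (F X))
    (hη : ∀ X Z (k : X ⟶ G.obj Z), ∃! l : F X ⟶ Z, η X ≫ G.map l = k) :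
    ∃ (L : C ⥤ D) (adj : L ⊣ G) (hL : ∀ X, L.obj X = F X),
      ∀ X, adj.unit.app X = η X ≫ G.map (eqToHom (hL X).symm) := by
  let e : ∀ X Z, (F X ⟶ Z) ≃ (X ⟶ G.obj Z) := fun X Z ↦
    Equiv.ofBijective (fun l ↦ η X ≫ G.map l)
      ((Function.bijective_iff_existsUnique _).2 (hη X Z))
  refine ⟨_, Adjunction.adjunctionOfEquivLeft e fun X Z Z' g h ↦ by simp [e], fun _ ↦ rfl,
    fun X ↦ ?_⟩
  rw [Adjunction.adjunctionOfEquivLeft_unit_app]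
  rfl

theorem isRightAdjoint_of_universal_arrows (G : D ⥤ C)
    (h : ∀ X, ∃ (F : D) (η : X ⟶ G.obj F),
      ∀ Z (k : X ⟶ G.obj Z), ∃! l : F ⟶ Z, η ≫ G.map l = k) : G.IsRightAdjoint := by
  choose F η hη using h
  obtain ⟨L, adj, -⟩ := exists_adjunction_of_universal_arrows G F η hη
  exact ⟨L, ⟨adj⟩⟩

theorem isEpireflective_of_universal_epis (Q : ObjectProperty C)
    (h : ∀ X, ∃ (F : Q.FullSubcategory) (η : X ⟶ F.obj), Epi η ∧
      ∀ (Z : Q.FullSubcategory) (k : X ⟶ Z.obj), ∃! l : F ⟶ Z, η ≫ l.hom = k) :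
    IsEpireflective Q := by
  choose F η hepi hη using h
  obtain ⟨L, adj, hL, hunit⟩ := exists_adjunction_of_universal_arrows Q.ι F η hη
  refine ⟨{ L := L, adj := adj }, fun X ↦ ?_⟩
  change Epi (adj.unit.app X)
  rw [hunit]
  have := hepi X
  exact epi_comp _ _

theorem IsEpireflective.exists_universal_epi {Q : ObjectProperty C} (h : IsEpireflective Q)
    (X : C) : ∃ (F : Q.FullSubcategory) (η : X ⟶ F.obj), Epi η ∧
      ∀ (Z : Q.FullSubcategory) (k : X ⟶ Z.obj), ∃ l : F ⟶ Z, η ≫ l.hom = k := by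
  obtain ⟨_, hepi⟩ := h
  refine ⟨(reflector Q.ι).obj X, (reflectorAdjunction Q.ι).unit.app X, hepi X, fun Z k ↦
    ⟨((reflectorAdjunction Q.ι).homEquiv X Z).symm k, ?_⟩⟩
  have := ((reflectorAdjunction Q.ι).homEquiv X Z).apply_symm_apply k
  rwa [Adjunction.homEquiv_unit] at this

theorem hasCoequalizers_of_exists (h : ∀ {A B : C} (f g : A ⟶ B), ∃ (Q : C) (q : B ⟶ Q),
    f ≫ q = g ≫ q ∧ ∀ Z (k : B ⟶ Z), f ≫ k = g ≫ k → ∃! l : Q ⟶ Z, q ≫ l = k) :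
    Limits.HasCoequalizers C := by
  have : ∀ {A B : C} {f g : A ⟶ B}, Limits.HasColimit (Limits.parallelPair f g) := by
    intro A B f g
    obtain ⟨Q, q, hq, hu⟩ := h f g
    exact ⟨⟨_, Limits.Cofork.IsColimit.ofExistsUnique (t := Limits.Cofork.ofπ q hq)
      fun s ↦ hu _ s.π s.condition⟩⟩
  exact Limits.hasCoequalizers_of_hasColimit_parallelPair C

theorem isRegularEpi_of_existsUnique {W A B : C} (l r : W ⟶ A) (h : A ⟶ B) (w : l ≫ h = r ≫ h)
    (hu : ∀ Z (k : A ⟶ Z), l ≫ k = r ≫ k → ∃! m : B ⟶ Z, h ≫ m = k) : IsRegularEpi h :=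
  ⟨⟨{ W := W, left := l, right := r, w := w
      isColimit := Limits.Cofork.IsColimit.ofExistsUnique fun s ↦ hu _ s.π s.condition }⟩⟩

theorem isRegularEpi_iff_surjective {X Y : Type u} (f : X ⟶ Y) :
    IsRegularEpi f ↔ Function.Surjective f := by
  refine ⟨fun _ ↦ (epi_iff_surjective f).1 (IsRegularEpi.getStruct f).epi, fun h ↦ ?_⟩
  obtain ⟨s, hs⟩ := h.hasRightInverse
  have hsf : ↾s ≫ f = 𝟙 Y := by
    ext y
    exact hs y
  -- a split epimorphism is the coequalizer of the induced idempotent and the identity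
  refine isRegularEpi_of_existsUnique (f ≫ ↾s) (𝟙 X) f (by simp [hsf]) fun Z k hk ↦
    ⟨↾s ≫ k, by simpa using hk, fun m hm ↦ ?_⟩
  rw [← hm, reassoc_of% hsf]

end Categorical

namespace UniformSubcategory

open Topology Filter Set Uniformity

variable {P : ObjectProperty UniformSpaceCat.{u}}

/-! ### Algebraic categories of uniform spaces in elementary terms -/

/-- A uniformly continuous map as a morphism of a full subcategory of uniform spaces. -/
def mkHom {P : ObjectProperty UniformSpaceCat.{u}} {X Y : P.FullSubcategory} (f : X.obj → Y.obj)
    (hf : UniformContinuous f) : X ⟶ Y :=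
  ObjectProperty.homMk (UniformSpaceCat.ofHom ⟨f, hf⟩)

theorem uniformContinuous_hom {X Y : UniformSpaceCat.{u}} (f : X ⟶ Y) :
    UniformContinuous (f : X → Y) :=
  f.hom.2

theorem hom_ext_iff {X Y : P.FullSubcategory} {f g : X ⟶ Y} :
    f = g ↔ (f.hom : X.obj → Y.obj) = g.hom :=
  ⟨fun h ↦ by rw [h], fun h ↦ ObjectProperty.hom_ext _ (UniformSpaceCat.hom_ext h)⟩

theorem coe_comp_hom {X Y Z : P.FullSubcategory} (f : X ⟶ Y) (g : Y ⟶ Z) :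
    ((f ≫ g).hom : X.obj → Z.obj) = g.hom ∘ f.hom :=
  rfl

theorem isRegularEpi_map_underlying_iff {X Y : P.FullSubcategory} (f : X ⟶ Y) :
    IsRegularEpi ((underlying P).map f) ↔ Function.Surjective (f.hom : X.obj → Y.obj) :=
  isRegularEpi_iff_surjective _

/-- In an algebraic category of uniform spaces every surjective uniformly continuous map `h` is
final: it is a regular epimorphism, so that every morphism `k` which is constant on the fibres of
`h` factors through `h` by a uniformly continuous map. -/
theorem exists_uniformContinuous_factor (hP : IsAlgebraicCategory (underlying P))
    {A B Z : Type u} [UniformSpace A] [UniformSpace B] [UniformSpace Z]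
    (hA : P (.of A)) (hB : P (.of B)) (hZ : P (.of Z)) {h : A → B} (hh : UniformContinuous h)
    (hsurj : Function.Surjective h) {k : A → Z} (hk : UniformContinuous k)
    (hfib : ∀ a a', h a = h a' → k a = k a') :
    ∃ l : B → Z, UniformContinuous l ∧ ∀ a, l (h a) = k a := by
  let A' : P.FullSubcategory := ⟨.of A, hA⟩
  let B' : P.FullSubcategory := ⟨.of B, hB⟩
  let Z' : P.FullSubcategory := ⟨.of Z, hZ⟩
  let h' : A' ⟶ B' := mkHom h hh
  let k' : A' ⟶ Z' := mkHom k hk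
  have : IsRegularEpi h' :=
    hP.reflects_regularEpi h' ((isRegularEpi_map_underlying_iff h').2 hsurj)
  let r := IsRegularEpi.getStruct h'
  have hr : r.left ≫ k' = r.right ≫ k' := by
    rw [hom_ext_iff]
    funext w
    exact hfib _ _ (congrFun (hom_ext_iff.1 r.w) w)
  obtain ⟨l, hl⟩ := Limits.Cofork.IsColimit.desc' r.isColimit k' hr
  exact ⟨l.hom, uniformContinuous_hom l.hom, fun a ↦ congrFun (hom_ext_iff.1 hl) a⟩

/-- An elementary criterion for a full subcategory of uniform spaces to be algebraic: it has
universal surjective quotients by arbitrary relations, it has free objects, and its surjective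
morphisms are final. -/
theorem isAlgebraicCategory_of_elementary
    (quot : ∀ B : UniformSpaceCat.{u}, P B → ∀ R : B → B → Prop, ∃ Q : UniformSpaceCat.{u}, P Q ∧
      ∃ q : B → Q, UniformContinuous q ∧ Function.Surjective q ∧ (∀ a b, R a b → q a = q b) ∧
        ∀ Z : UniformSpaceCat.{u}, P Z → ∀ k : B → Z, UniformContinuous k →
          (∀ a b, R a b → k a = k b) → ∃ l : Q → Z, UniformContinuous l ∧ l ∘ q = k)
    (free : ∀ S : Type u, ∃ F : UniformSpaceCat.{u}, P F ∧ ∃ η : S → F,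
      ∀ Z : UniformSpaceCat.{u}, P Z → ∀ k : S → Z,
        ∃! l : F → Z, UniformContinuous l ∧ l ∘ η = k)
    (final : ∀ A B Z : UniformSpaceCat.{u}, P A → P B → P Z → ∀ h : A → B, UniformContinuous h →
      Function.Surjective h → ∀ l : B → Z, UniformContinuous (l ∘ h) → UniformContinuous l) :
    IsAlgebraicCategory (underlying P) := by
  have coeq : ∀ {A B : P.FullSubcategory} (f g : A ⟶ B), ∃ (Q : P.FullSubcategory) (q : B ⟶ Q),
      Function.Surjective (q.hom : B.obj → Q.obj) ∧ f ≫ q = g ≫ q ∧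
        ∀ Z (k : B ⟶ Z), f ≫ k = g ≫ k → ∃! l : Q ⟶ Z, q ≫ l = k := by
    intro A B f g
    obtain ⟨Q, hQ, q, hq, hqs, hqR, hu⟩ :=
      quot B.obj B.property fun b b' ↦ ∃ a, f.hom a = b ∧ g.hom a = b'
    refine ⟨⟨Q, hQ⟩, mkHom q hq, hqs, ?_, fun Z k hk ↦ ?_⟩
    · rw [hom_ext_iff]
      funext a
      exact hqR _ _ ⟨a, rfl, rfl⟩
    · obtain ⟨l, hl, hlq⟩ := hu Z.obj Z.property k.hom (uniformContinuous_hom _) (by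
        rintro _ _ ⟨a, rfl, rfl⟩
        exact congrFun (hom_ext_iff.1 hk) a)
      refine ⟨mkHom l hl, hom_ext_iff.2 hlq, fun m hm ↦ hom_ext_iff.2 ?_⟩
      exact hqs.injective_comp_right ((hom_ext_iff.1 hm).trans hlq.symm)
  refine ⟨hasCoequalizers_of_exists fun f g ↦ ?_, isRightAdjoint_of_universal_arrows _ fun S ↦ ?_,
    fun {X Y} f hf ↦ ?_, fun {X Y} f hf ↦ ?_⟩
  · obtain ⟨Q, q, -, h⟩ := coeq f g
    exact ⟨Q, q, h⟩
  · obtain ⟨F, hF, η, hη⟩ := free S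
    refine ⟨⟨F, hF⟩, ↾η, fun Z k ↦ ?_⟩
    obtain ⟨l, ⟨hl, hlη⟩, huniq⟩ := hη Z.obj Z.property k
    refine ⟨mkHom l hl, ?_, fun m hm ↦ hom_ext_iff.2 (huniq _ ⟨uniformContinuous_hom m.hom, ?_⟩)⟩
    · ext s
      exact congrFun hlη s
    · funext s
      exact ConcreteCategory.congr_hom hm s
  · -- a regular epimorphism is isomorphic to a quotient map, which is surjective
    rw [isRegularEpi_map_underlying_iff]
    let r := IsRegularEpi.getStruct f
    obtain ⟨Q, q, hqs, hq, hu⟩ := coeq r.left r.right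
    obtain ⟨m, hm, -⟩ := hu Y f r.w
    obtain ⟨n, hn⟩ := Limits.Cofork.IsColimit.desc' r.isColimit q hq
    have hn' : f ≫ n = q := hn
    have hnm : n ≫ m = 𝟙 Y := by
      have := r.epi
      rw [← cancel_epi f, reassoc_of% hn', hm, Category.comp_id]
    intro y
    obtain ⟨x, hx⟩ := hqs (n.hom y)
    refine ⟨x, ?_⟩
    rw [← congrFun (hom_ext_iff.1 hm) x, coe_comp_hom, Function.comp_apply, hx]
    exact congrFun (hom_ext_iff.1 hnm) y
  · -- a surjection is the coequalizer of the two projections from the free object on its kernel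
    have hs := (isRegularEpi_map_underlying_iff f).1 hf
    obtain ⟨F, hF, η, hη⟩ := free {p : X.obj × X.obj // f.hom p.1 = f.hom p.2}
    obtain ⟨l, ⟨hl, hlη⟩, -⟩ := hη X.obj X.property fun p ↦ p.1.1
    obtain ⟨r, ⟨hr, hrη⟩, -⟩ := hη X.obj X.property fun p ↦ p.1.2
    refine isRegularEpi_of_existsUnique (W := ⟨F, hF⟩) (mkHom l hl) (mkHom r hr) f
      (hom_ext_iff.2 ?_) fun Z k hk ↦ ?_
    · refine (hη Y.obj Y.property fun p ↦ f.hom p.1.1).unique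
        ⟨(uniformContinuous_hom f.hom).comp hl, ?_⟩ ⟨(uniformContinuous_hom f.hom).comp hr, ?_⟩
      · funext p
        exact congrArg f.hom (congrFun hlη p)
      · funext p
        exact (congrArg f.hom (congrFun hrη p)).trans p.2.symm
    · have hfib : ∀ x x', f.hom x = f.hom x' → k.hom x = k.hom x' := fun x x' hxx ↦ by
        have := congrFun (hom_ext_iff.1 hk) (η ⟨(x, x'), hxx⟩)
        have h1 := congrFun hlη ⟨(x, x'), hxx⟩
        have h2 := congrFun hrη ⟨(x, x'), hxx⟩
        simp only [Function.comp_apply] at h1 h2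
        change k.hom (l _) = k.hom (r _) at this
        rwa [h1, h2] at this
      obtain ⟨s, hs'⟩ := hs.hasRightInverse
      have hfac : (k.hom ∘ s) ∘ f.hom = k.hom := funext fun x ↦ hfib _ _ (hs' _)
      refine ⟨mkHom (k.hom ∘ s) (final X.obj Y.obj Z.obj X.property Y.property Z.property f.hom
        (uniformContinuous_hom _) hs _ ?_), hom_ext_iff.2 hfac, fun m hm ↦ hom_ext_iff.2 ?_⟩
      · rw [hfac]
        exact uniformContinuous_hom _
      · exact hs.injective_comp_right ((hom_ext_iff.1 hm).trans hfac.symm)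

/-! ### Compactness and chains of closed sets -/

/-- In a space which is not compact some chain of nonempty closed sets has empty intersection.
A family of closed sets of least cardinality with the finite intersection property and empty
intersection, well-ordered by the initial ordinal of its cardinality, has nonempty initial
intersections. -/
theorem exists_antitone_isClosed_of_not_compactSpace {X : Type u} [TopologicalSpace X]
    (hX : ¬ CompactSpace X) :
    ∃ (ι : Type u) (_ : LinearOrder ι) (D : ι → Set X), Antitone D ∧ (∀ i, IsClosed (D i)) ∧
      (∀ i, (D i).Nonempty) ∧ ⋂ i, D i = ∅ := by
  by_contra! H
  have key : ∀ (c : Cardinal.{u}) (ι : Type u), Cardinal.mk ι = c → ∀ A : ι → Set X,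
      (∀ i, IsClosed (A i)) → (∀ s : Finset ι, (⋂ i ∈ s, A i).Nonempty) →
        (⋂ i, A i).Nonempty := by
    intro c
    induction c using WellFoundedLT.induction with
    | ind c ih =>
      intro ι hι A hA hfip
      rcases finite_or_infinite ι with _ | _
      · cases nonempty_fintype ι
        simpa using hfip Finset.univ
      · obtain ⟨_, _, hord⟩ := Cardinal.exists_ord_eq_type_lt ι
        have hne : ∀ i : ι, (⋂ j : Iic i, A j).Nonempty := by
          intro i
          have hcard : Cardinal.mk (Iic i) < c := by
            rw [← hι, ← Iio_insert]
            exact Cardinal.mk_insert_le.trans_lt (Cardinal.add_lt_of_lt (Cardinal.aleph0_le_mk ι)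
              (Cardinal.mk_Iio_lt i hord)
              (Cardinal.one_lt_aleph0.trans_le (Cardinal.aleph0_le_mk ι)))
          refine ih _ hcard _ rfl _ (fun j ↦ hA j) fun s ↦ ?_
          refine (hfip (s.map (Function.Embedding.subtype _))).mono fun x hx ↦ ?_
          simp only [mem_iInter] at hx ⊢
          exact fun j hj ↦ hx j (Finset.mem_map_of_mem _ hj)
        obtain ⟨x, hx⟩ := H ι inferInstance (fun i ↦ ⋂ j : Iic i, A j)
          (fun i j hij x hx ↦ mem_iInter.2 fun k ↦ mem_iInter.1 hx ⟨k, k.2.trans hij⟩)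
          (fun i ↦ isClosed_iInter fun j ↦ hA j) hne
        exact ⟨x, mem_iInter.2 fun i ↦ mem_iInter.1 (mem_iInter.1 hx i) ⟨i, le_rfl⟩⟩
  refine hX ⟨isCompact_of_finite_subfamily_closed fun {ι} A hA h ↦ ?_⟩
  by_contra! hfip
  have := key _ ι rfl A hA fun s ↦ by simpa using hfip s
  simp_all

/-! ### Consequences of the closure properties -/

theorem ClosedUnderClosedSubspaces.subtype (hP : ClosedUnderClosedSubspaces P) {X : Type u}
    [UniformSpace X] (hX : P (.of X)) {s : Set X} (hs : IsClosed s) : P (.of s) :=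
  hP (UniformSpaceCat.ofHom ⟨_, uniformContinuous_subtype_val⟩)
    (isUniformEmbedding_subtype_val (p := (· ∈ s)))
    (by
      change IsClosed (range (Subtype.val : s → X))
      rwa [Subtype.range_val]) hX

theorem ClosedUnderProducts.pi (hP : ClosedUnderProducts P) {X : Type u}
    [UniformSpace X] (hX : P (.of X)) (J : Type u) : P (.of (J → X)) :=
  hP J (fun _ ↦ .of X) fun _ ↦ hX

theorem prop_of_uniformEquiv [P.IsClosedUnderIsomorphisms] {X Y : Type u} [UniformSpace X]
    [UniformSpace Y] (e : X ≃ᵤ Y) (hX : P (.of X)) : P (.of Y) :=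
  P.prop_of_iso (X := .of X) (Y := .of Y)
    { hom := UniformSpaceCat.ofHom ⟨e, e.uniformContinuous⟩
      inv := UniformSpaceCat.ofHom ⟨e.symm, e.symm.uniformContinuous⟩
      hom_inv_id := by
        ext x
        exact e.symm_apply_apply x
      inv_hom_id := by
        ext x
        exact e.apply_symm_apply x } hX

theorem isClosed_setOf_forall {X : Type*} [TopologicalSpace X] {ι : Sort*} {p : ι → X → Prop}
    (h : ∀ i, IsClosed {x | p i x}) : IsClosed {x | ∀ i, p i x} := by
  rw [ofPred_forall]
  exact isClosed_iInter h

/-! ### Separated members of an algebraic subcategory are compact -/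

/-- Suppose that `D` is a chain of nonempty closed sets with empty intersection, indexed by a
linear order `ι`, and code subsets of `ι` by points of `ι → X` with values in `{x₀, x₁}`. The
lower sets form a closed set `L`, and those pairs of a lower set `b` and a point of `⋂ i ∈ b, D i`
form a closed set, whose projection to `L` misses exactly the greatest lower set `ι`. After adding
a disjoint copy of `X` lying over `ι` the projection becomes surjective, hence final, so that `ι` is
isolated in `L`; but it is the limit of the lower sets `Iic i`. -/
theorem compactSpace_of_isAlgebraicCategory (hprod : ClosedUnderProducts P)
    (hclosed : ClosedUnderClosedSubspaces P) (halg : IsAlgebraicCategory (underlying P))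
    {X : Type u} [UniformSpace X] [T2Space X] (hX : P (.of X)) : CompactSpace X := by
  by_contra hcomp
  have : Nontrivial X := by
    by_contra hnt
    rw [not_nontrivial_iff_subsingleton] at hnt
    exact hcomp inferInstance
  obtain ⟨x₀, x₁, hx⟩ := exists_pair_ne X
  obtain ⟨ι, _, D, hanti, hD, hne, hD0⟩ := exists_antitone_isClosed_of_not_compactSpace hcomp
  let L : Set (ι → X) :=
    {b | (∀ i, b i = x₀ ∨ b i = x₁) ∧ ∀ i j, i ≤ j → b j = x₀ ∨ b i = x₁}
  have hL : IsClosed L := by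
    refine IsClosed.inter (isClosed_setOf_forall fun i ↦ ?_) (isClosed_setOf_forall fun i ↦
      isClosed_setOf_forall fun j ↦ isClosed_setOf_forall fun _ ↦ ?_)
    · exact (isClosed_eq (continuous_apply i) continuous_const).union
        (isClosed_eq (continuous_apply i) continuous_const)
    · exact (isClosed_eq (continuous_apply j) continuous_const).union
        (isClosed_eq (continuous_apply i) continuous_const)
  -- coordinate `none` is a point of `X`, coordinate `some none` marks the added copy of `X`
  let Y : Set (Option (Option ι) → X) :=
    {z | (fun i ↦ z (some (some i))) ∈ L ∧
      ((z (some none) = x₀ ∧ ∀ i, z (some (some i)) = x₀ ∨ z none ∈ D i) ∨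
        (z (some none) = x₁ ∧ ∀ i, z (some (some i)) = x₁))}
  have hY : IsClosed Y := by
    refine IsClosed.inter (hL.preimage (by fun_prop)) (IsClosed.union (IsClosed.inter ?_
      (isClosed_setOf_forall fun i ↦ IsClosed.union ?_ ?_)) (IsClosed.inter ?_
        (isClosed_setOf_forall fun i ↦ ?_)))
    · exact isClosed_eq (continuous_apply _) continuous_const
    · exact isClosed_eq (continuous_apply _) continuous_const
    · exact (hD i).preimage (continuous_apply _)
    · exact isClosed_eq (continuous_apply _) continuous_const
    · exact isClosed_eq (continuous_apply _) continuous_const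
  let h : Y → L := fun z ↦ ⟨fun i ↦ z.1 (some (some i)), z.2.1⟩
  have hh : UniformContinuous h := by
    refine UniformContinuous.subtype_mk (uniformContinuous_pi.2 fun i ↦ ?_) _
    exact (Pi.uniformContinuous_proj _ (some (some i))).comp uniformContinuous_subtype_val
  have hsurj : Function.Surjective h := by
    rintro ⟨b, hb⟩
    by_cases hb1 : ∀ i, b i = x₁
    · exact ⟨⟨fun o ↦ o.elim x₀ fun o' ↦ o'.elim x₁ b, hb, Or.inr ⟨rfl, hb1⟩⟩, rfl⟩
    · push Not at hb1
      obtain ⟨i, hi⟩ := hb1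
      obtain ⟨x, hx⟩ := hne i
      refine ⟨⟨fun o ↦ o.elim x fun o' ↦ o'.elim x₀ b, hb, Or.inl ⟨rfl, fun j ↦ ?_⟩⟩, rfl⟩
      rcases le_total i j with hij | hij
      · exact Or.inl ((hb.2 i j hij).resolve_right hi)
      · exact Or.inr (hanti hij hx)
  obtain ⟨l, hl, hlk⟩ := exists_uniformContinuous_factor halg
    (hclosed.subtype (hprod.pi hX _) hY) (hclosed.subtype (hprod.pi hX _) hL) hX hh hsurj
    (k := fun z ↦ z.1 (some none))
    ((Pi.uniformContinuous_proj _ (some none)).comp uniformContinuous_subtype_val) (by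
      have aux : ∀ z z' : Y, h z = h z' → z.1 (some none) = x₀ →
          z'.1 (some none) = x₁ → False := by
        rintro z z' hzz hz hz'
        have hD' : z.1 none ∈ ⋂ i, D i := mem_iInter.2 fun i ↦ by
          have h1 : z'.1 (some (some i)) = x₁ := by
            rcases z'.2.2 with h | h
            · exact absurd (h.1.symm.trans hz') hx
            · exact h.2 i
          have h2 : z.1 (some (some i)) = x₁ :=
            (congrFun (congrArg Subtype.val hzz) i).trans h1
          rcases z.2.2 with h | h
          · exact (h.2 i).resolve_left fun h3 ↦ hx (h3.symm.trans h2)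
          · exact absurd (hz.symm.trans h.1) hx
        rw [hD0] at hD'
        exact hD'
      intro z z' hzz
      rcases z.2.2 with h | h <;> rcases z'.2.2 with h' | h'
      · exact h.1.trans h'.1.symm
      · exact (aux z z' hzz h.1 h'.1).elim
      · exact (aux z' z hzz.symm h'.1 h.1).elim
      · exact h.1.trans h'.1.symm)
  classical
  let top : L := ⟨fun _ ↦ x₁, fun _ ↦ Or.inr rfl, fun _ _ _ ↦ Or.inr rfl⟩
  let c : ι → L := fun i ↦ ⟨fun j ↦ if j ≤ i then x₁ else x₀,
    fun j ↦ by
      dsimp only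
      split_ifs <;> simp,
    fun j k hjk ↦ by
      by_cases hk : k ≤ i
      · simp [hjk.trans hk]
      · simp [hk]⟩
  have hx₁ : l top = x₁ :=
    hlk ⟨fun o ↦ o.elim x₀ fun _ ↦ x₁, top.2, Or.inr ⟨rfl, fun _ ↦ rfl⟩⟩
  have hx₀ : ∀ i, l (c i) = x₀ := by
    intro i
    obtain ⟨z, hz⟩ := hsurj (c i)
    rw [← hz, hlk]
    refine (z.2.2.resolve_right fun h' ↦ ?_).1
    have hmem : ∀ j, j ≤ i := fun j ↦ by
      by_contra hj
      have h1 : z.1 (some (some j)) = if j ≤ i then x₁ else x₀ :=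
        congrFun (congrArg Subtype.val hz) j
      rw [if_neg hj] at h1
      exact hx (h1.symm.trans (h'.2 j))
    -- if `i` were the greatest index, the intersection of the chain would be `D i`
    obtain ⟨x, hxi⟩ := hne i
    have : x ∈ ⋂ j, D j := mem_iInter.2 fun j ↦ hanti (hmem j) hxi
    rw [hD0] at this
    exact this
  have : Nonempty ι := by
    by_contra hι
    rw [not_nonempty_iff] at hι
    rw [iInter_of_empty] at hD0
    exact univ_nonempty.ne_empty hD0
  have hlim : Tendsto c atTop (𝓝 top) := by
    refine tendsto_subtype_rng.2 (tendsto_pi_nhds.2 fun j ↦ ?_)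
    refine tendsto_const_nhds.congr' ?_
    filter_upwards [eventually_ge_atTop j] with i hi
    simp [c, top, hi]
  have h1 := (hl.continuous.tendsto top).comp hlim
  rw [hx₁] at h1
  exact hx (tendsto_nhds_unique (tendsto_const_nhds.congr fun i ↦ (hx₀ i).symm) h1)

/-! ### Indiscrete spaces -/

theorem indiscrete_iff {X : UniformSpaceCat.{u}} : indiscrete X ↔ ∀ V ∈ 𝓤 X, V = univ :=
  ⟨fun h V hV ↦ by rwa [show 𝓤 X = ⊤ from h, mem_top] at hV,
    fun h ↦ top_unique fun V hV ↦ mem_top.2 (h V hV)⟩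

theorem uniformContinuous_of_indiscrete {X : Type*} [UniformSpace X] {Y : UniformSpaceCat.{u}}
    (hY : indiscrete Y) (f : X → Y) : UniformContinuous f := by
  rw [UniformContinuous, show 𝓤 Y = ⊤ from hY]
  exact tendsto_top

theorem closedUnderProducts_indiscrete : ClosedUnderProducts indiscrete.{u} := by
  intro J X hX
  change 𝓤 (∀ j, X j) = ⊤
  rw [Pi.uniformity]
  refine iInf_eq_top.2 fun j ↦ ?_
  rw [show 𝓤 (X j) = ⊤ from hX j, comap_top]

theorem closedUnderClosedSubspaces_indiscrete : ClosedUnderClosedSubspaces indiscrete.{u} := by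
  intro D C m hm _ hC
  change 𝓤 D = ⊤
  rw [← hm.comap_uniformity, show 𝓤 C = ⊤ from hC, comap_top]

/-- If `P` contains an indiscrete space `I` with two points, then it contains only indiscrete
spaces: for a large power `W` of `I` there is a bijection of `Z × W` onto the indiscrete space `W`.
This bijection is final, so that the projection of `Z × W` to `Z` is a quotient of `W`. -/
theorem le_indiscrete_of_nontrivial (hprod : ClosedUnderProducts P)
    (halg : IsAlgebraicCategory (underlying P)) {I : UniformSpaceCat.{u}} [Nontrivial I]
    (hI : P I) (hI' : indiscrete I) : P ≤ indiscrete := by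
  intro Z hZ
  rcases isEmpty_or_nonempty Z with _ | _
  · exact Subsingleton.elim (𝓤 Z) ⊤
  let J : Type u := Z ⊕ ULift.{u} ℕ
  let F : Option J → UniformSpaceCat.{u} := fun o ↦ o.elim Z fun _ ↦ I
  have hF : P (.of (∀ o, F o)) := hprod _ F fun o ↦ by cases o <;> assumption
  have hW : indiscrete (.of (J → I)) := closedUnderProducts_indiscrete _ _ fun _ ↦ hI'
  have hJW : Cardinal.mk J ≤ Cardinal.mk (J → I) := by
    rw [← Cardinal.power_def]
    exact (Cardinal.cantor' _ ((Cardinal.one_lt_iff_nontrivial).2 ‹_›)).le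
  have hcard : Cardinal.mk (Z × (J → I)) = Cardinal.mk (J → I) := by
    rw [← Cardinal.mul_def]
    refine Cardinal.mul_eq_right ?_ ?_ (Cardinal.mk_ne_zero _)
    · exact (Cardinal.aleph0_le_mk J).trans hJW
    · exact (Cardinal.mk_le_of_injective Sum.inl_injective).trans hJW
  obtain ⟨e⟩ := Cardinal.eq.1 hcard
  let p : (∀ o, F o) ≃ Z × (J → I) := Equiv.piOptionEquivProd (β := fun o ↦ F o)
  obtain ⟨l, hl, hlk⟩ := exists_uniformContinuous_factor halg hF (hprod J (fun _ ↦ I) fun _ ↦ hI)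
    hZ (h := p.trans e) (uniformContinuous_of_indiscrete hW _) (p.trans e).surjective
    (k := fun z ↦ z none) (Pi.uniformContinuous_proj _ none)
    fun a a' h ↦ by rw [(p.trans e).injective h]
  have hsurj : Function.Surjective l := fun z ↦ by
    obtain ⟨w⟩ : Nonempty (J → I) := inferInstance
    have h := hlk (p.symm (z, w))
    rw [Equiv.trans_apply, Equiv.apply_symm_apply] at h
    exact ⟨e (z, w), h⟩
  refine indiscrete_iff.2 fun V hV ↦ ?_
  have hV' := indiscrete_iff.1 hW _ (hl hV)
  refine eq_univ_of_forall fun z ↦ ?_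
  obtain ⟨a, ha⟩ := hsurj z.1
  obtain ⟨b, hb⟩ := hsurj z.2
  have : (a, b) ∈ (fun x : (J → I) × (J → I) ↦ (l x.1, l x.2)) ⁻¹' V := hV' ▸ mem_univ _
  simpa [ha, hb] using this

/-- Every indiscrete space is a coequalizer of two maps between powers of a two-point indiscrete
space, namely of the idempotent given by a retraction onto a set of the given cardinality and of
the identity. -/
theorem indiscrete_le_of_nontrivial (hprod : ClosedUnderProducts P)
    (hclosed : ClosedUnderClosedSubspaces P) (halg : IsAlgebraicCategory (underlying P))
    {I : UniformSpaceCat.{u}} [Nontrivial I] (hI : P I) (hI' : indiscrete I) :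
    indiscrete ≤ P := by
  classical
  have hle := le_indiscrete_of_nontrivial hprod halg hI hI'
  -- it suffices to inject the given space onto a space in `P`
  have main : ∀ (S : UniformSpaceCat.{u}) (C : UniformSpaceCat.{u}), indiscrete S → P C →
      ∀ f : S → C, Function.Injective f → IsClosed (range f) → P S := by
    intro S C hS hC f hf hr
    refine hclosed (UniformSpaceCat.ofHom ⟨f, uniformContinuous_of_indiscrete (hle C hC) f⟩)
      ⟨⟨?_⟩, hf⟩ hr hC
    rw [show 𝓤 C = ⊤ from hle C hC, comap_top]
    exact hS.symm
  intro S hS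
  rcases isEmpty_or_nonempty S with _ | _
  · refine main S I hS hI isEmptyElim (fun x ↦ isEmptyElim x) ?_
    rw [range_eq_empty]
    exact isClosed_empty
  obtain ⟨i₀, i₁, hi⟩ := exists_pair_ne I
  let W : P.FullSubcategory := ⟨.of (S → I), hprod S (fun _ ↦ I) fun _ ↦ hI⟩
  let s : S → W.obj := fun a b ↦ if b = a then i₁ else i₀
  have hs : Function.Injective s := fun a b hab ↦ by
    by_contra hne
    have := congrFun hab a
    simp [s, hne, hi.symm] at this
  let e : W.obj → S := Function.invFun s
  have he : ∀ a, e (s a) = a := Function.leftInverse_invFun hs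
  let f : W ⟶ W := mkHom (s ∘ e) (uniformContinuous_of_indiscrete (hle _ W.property) _)
  have := halg.hasCoequalizers
  let q := Limits.coequalizer.π f (𝟙 W)
  have hq : ∀ w, q.hom (s (e w)) = q.hom w :=
    congrFun (hom_ext_iff.1 (Limits.coequalizer.condition f (𝟙 W)))
  have hqs : Function.Surjective q.hom := by
    rw [← isRegularEpi_map_underlying_iff]
    exact halg.preserves_regularEpi q
      ⟨⟨{ W := W, left := f, right := 𝟙 W, w := Limits.coequalizer.condition f (𝟙 W)
          isColimit := Limits.coequalizerIsCoequalizer f (𝟙 W) }⟩⟩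
  have hff : f ≫ f = 𝟙 W ≫ f := by
    rw [hom_ext_iff]
    funext w
    change s (e (s (e w))) = s (e w)
    rw [he]
  have hr : ∀ w, (Limits.coequalizer.desc f hff).hom (q.hom w) = s (e w) :=
    congrFun (hom_ext_iff.1 (Limits.coequalizer.π_desc f hff))
  refine main S _ hS (Limits.coequalizer f (𝟙 W)).property (fun a ↦ q.hom (s a))
    (fun a b hab ↦ ?_) ?_
  · have := congrArg (Limits.coequalizer.desc f hff).hom hab
    dsimp only at this
    rw [hr, hr, he, he] at this
    exact hs this
  · rw [Function.Surjective.range_eq]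
    · exact isClosed_univ
    · intro y
      obtain ⟨w, rfl⟩ := hqs y
      exact ⟨e w, hq w⟩

theorem exists_indiscrete_of_not_t0Space (hclosed : ClosedUnderClosedSubspaces P)
    {X : UniformSpaceCat.{u}} (hX : P X) (h : ¬ T0Space X) :
    ∃ I : UniformSpaceCat.{u}, Nontrivial I ∧ P I ∧ indiscrete I := by
  rw [t0Space_iff_inseparable] at h
  push Not at h
  obtain ⟨x, y, hxy, hne⟩ := h
  have hy : y ∈ closure {x} := hxy.specializes.mem_closure
  refine ⟨.of (closure {x}), ⟨⟨x, subset_closure rfl⟩, ⟨y, hy⟩, fun h ↦ hne (congrArg Subtype.val h)⟩,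
    hclosed.subtype (X := X) hX isClosed_closure, indiscrete_iff.2 fun V hV ↦ ?_⟩
  have hV' : V ∈ comap (fun q : closure {x} × closure {x} ↦ ((q.1 : X), (q.2 : X))) (𝓤 X) := hV
  obtain ⟨U, hU, hUV⟩ := mem_comap.1 hV'
  refine eq_univ_of_forall fun z ↦ hUV ?_
  have hz : ∀ a : closure {x}, Inseparable x a := fun a ↦
    (specializes_iff_mem_closure.2 a.2).inseparable
  exact (inseparable_iff_ker_uniformity.1 ((hz z.1).symm.trans (hz z.2))) U hU

theorem eq_indiscrete_of_not_t0Space (hprod : ClosedUnderProducts P)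
    (hclosed : ClosedUnderClosedSubspaces P) (halg : IsAlgebraicCategory (underlying P))
    {X : UniformSpaceCat.{u}} (hX : P X) (h : ¬ T0Space X) : P = indiscrete := by
  obtain ⟨I, _, hI, hI'⟩ := exists_indiscrete_of_not_t0Space hclosed hX h
  exact le_antisymm (le_indiscrete_of_nontrivial hprod halg hI hI')
    (indiscrete_le_of_nontrivial hprod hclosed halg hI hI')

theorem isAlgebraicCategory_indiscrete : IsAlgebraicCategory (underlying indiscrete.{u}) := by
  refine isAlgebraicCategory_of_elementary (fun B _ R ↦ ?_) (fun S ↦ ?_)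
    (fun _ _ _ _ _ hZ _ _ _ l _ ↦ uniformContinuous_of_indiscrete hZ l)
  · let _ : UniformSpace (Quot R) := ⊤
    have hQ : indiscrete (.of (Quot R)) := top_uniformity
    refine ⟨.of (Quot R), hQ, Quot.mk R, uniformContinuous_of_indiscrete hQ _,
      Quot.mk_surjective, fun a b ↦ Quot.sound, fun Z hZ k _ hk ↦ ?_⟩
    exact ⟨Quot.lift k hk, uniformContinuous_of_indiscrete hZ _, rfl⟩
  · let _ : UniformSpace S := ⊤
    refine ⟨.of S, top_uniformity, id, fun Z hZ k ↦
      ⟨k, ⟨uniformContinuous_of_indiscrete hZ k, rfl⟩, fun l hl ↦ hl.2⟩⟩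

/-! ### Epireflective subcategories of compact Hausdorff spaces -/

theorem uniformContinuous_of_comp_surjective {A B Z : Type*} [UniformSpace A] [UniformSpace B]
    [UniformSpace Z] [CompactSpace A] [CompactSpace B] [T2Space B] {h : A → B} {l : B → Z}
    (hh : Continuous h) (hs : Function.Surjective h) (hl : Continuous (l ∘ h)) :
    UniformContinuous l :=
  CompactSpace.uniformContinuous_of_continuous
    ((hh.isClosedMap.isQuotientMap hh hs).continuous_iff.2 hl)

/-- Let `P` consist of compact Hausdorff spaces and be closed under products and closed subspaces.
The universal quotient in `P` of a compact space `X` by a relation `R` is the image of `X` in the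
product of one space in `P` for each kernel of a morphism from `X` to `P` which respects `R`. -/
theorem exists_universal_quotient (hP : P ≤ compactT2) (hprod : ClosedUnderProducts P)
    (hclosed : ClosedUnderClosedSubspaces P) (X : Type u) [UniformSpace X] [CompactSpace X]
    (R : X → X → Prop) :
    ∃ Q : UniformSpaceCat.{u}, P Q ∧ ∃ q : X → Q, UniformContinuous q ∧ Function.Surjective q ∧
      (∀ a b, R a b → q a = q b) ∧ ∀ Z : UniformSpaceCat.{u}, P Z → ∀ k : X → Z,
        UniformContinuous k → (∀ a b, R a b → k a = k b) →
          ∃ l : Q → Z, UniformContinuous l ∧ l ∘ q = k := by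
  let K : Type u := {r : Setoid X // ∃ Z : UniformSpaceCat.{u}, P Z ∧ ∃ k : X → Z,
    UniformContinuous k ∧ (∀ a b, R a b → k a = k b) ∧ Setoid.ker k = r}
  choose Y hY g hg hgR hgker using fun r : K ↦ r.2
  let G : X → ∀ r, Y r := fun x r ↦ g r x
  have hG : UniformContinuous G := uniformContinuous_pi.2 hg
  have hYc := fun r ↦ (hP _ (hY r)).1
  have hYt := fun r ↦ (hP _ (hY r)).2
  have hrange : IsClosed (range G) := (isCompact_range hG.continuous).isClosed
  have hQ : P (.of (range G)) := hclosed.subtype (hprod K Y hY) hrange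
  have hQc : CompactSpace (range G) := (hP _ hQ).1
  let q : X → range G := rangeFactorization G
  have hq : UniformContinuous q := hG.subtype_mk _
  have hqs : Function.Surjective q := rangeFactorization_surjective
  refine ⟨.of (range G), hQ, q, hq, hqs, fun a b hab ↦ ?_, fun Z hZ k hk hkR ↦ ?_⟩
  · exact Subtype.ext (funext fun r ↦ hgR r a b hab)
  · obtain ⟨s, hs⟩ := hqs.hasRightInverse
    let r : K := ⟨Setoid.ker k, Z, hZ, k, hk, hkR, rfl⟩
    have hfac : (k ∘ s) ∘ q = k := funext fun x ↦ by
      have h1 : g r (s (q x)) = g r x := congrFun (congrArg Subtype.val (hs (q x))) r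
      have h2 : Setoid.ker (g r) (s (q x)) x := h1
      rw [hgker r] at h2
      exact h2
    refine ⟨k ∘ s, uniformContinuous_of_comp_surjective hq.continuous hqs ?_, hfac⟩
    rw [hfac]
    exact hk.continuous

/-- The Stone–Čech compactification of the discrete space `S` with its unique uniformity maps
onto the free object on `S`. -/
theorem isAlgebraicCategory_of_le_compactT2 (hP : P ≤ compactT2) (hprod : ClosedUnderProducts P)
    (hclosed : ClosedUnderClosedSubspaces P) : IsAlgebraicCategory (underlying P) := by
  refine isAlgebraicCategory_of_elementary (fun B hB R ↦ ?_) (fun S ↦ ?_)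
    (fun A B Z hA hB hZ h hh hs l hl ↦ ?_)
  · have := (hP B hB).1
    exact exists_universal_quotient hP hprod hclosed B R
  · let _ : UniformSpace (Ultrafilter S) := uniformSpaceOfCompactR1
    obtain ⟨Q, hQ, q, hq, hqs, -, hu⟩ :=
      exists_universal_quotient hP hprod hclosed (Ultrafilter S) fun _ _ ↦ False
    refine ⟨Q, hQ, q ∘ pure, fun Z hZ k ↦ ?_⟩
    obtain ⟨_, _⟩ := hP Z hZ
    obtain ⟨l, hl, hlq⟩ := hu Z hZ (Ultrafilter.extend k)
      (CompactSpace.uniformContinuous_of_continuous (continuous_ultrafilter_extend k)) (by simp)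
    have hlk : l ∘ q ∘ pure = k := by
      rw [← Function.comp_assoc, hlq, ultrafilter_extend_extends]
    refine ⟨l, ⟨hl, hlk⟩, fun m hm ↦ ?_⟩
    exact (hqs.denseRange.comp denseRange_pure hq.continuous).equalizer hm.1.continuous
      hl.continuous (hm.2.trans hlk.symm)
  · obtain ⟨_, _⟩ := hP A hA
    obtain ⟨_, _⟩ := hP B hB
    exact uniformContinuous_of_comp_surjective hh.continuous hs hl.continuous

theorem isEpireflectiveIn_compactT2 (hP : P ≤ compactT2) (hprod : ClosedUnderProducts P)
    (hclosed : ClosedUnderClosedSubspaces P) : IsEpireflectiveIn P compactT2 := by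
  refine ⟨hP, isEpireflective_of_universal_epis _ fun X ↦ ?_⟩
  have := X.property.1
  obtain ⟨Q, hQ, q, hq, hqs, -, hu⟩ :=
    exists_universal_quotient hP hprod hclosed X.obj fun _ _ ↦ False
  let Q' : (P.inverseImage compactT2.ι).FullSubcategory := ⟨⟨Q, hP _ hQ⟩, hQ⟩
  let η : X ⟶ Q'.obj := mkHom q hq
  have hcancel : ∀ {Z : compactT2.FullSubcategory} (a b : Q'.obj ⟶ Z), η ≫ a = η ≫ b → a = b :=
    fun a b hab ↦ hom_ext_iff.2 (hqs.injective_comp_right (hom_ext_iff.1 hab))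
  refine ⟨Q', η, ⟨fun a b ↦ hcancel a b⟩, fun Z k ↦ ?_⟩
  obtain ⟨l, hl, hlq⟩ := hu Z.obj.obj Z.property k.hom (uniformContinuous_hom _) (by simp)
  have hl' : η ≫ (mkHom l hl : Q'.obj ⟶ Z.obj) = k := hom_ext_iff.2 hlq
  exact ⟨ObjectProperty.homMk (mkHom l hl), hl',
    fun m hm ↦ ObjectProperty.hom_ext _ (hcancel _ _ (hm.trans hl'.symm))⟩

/-- Epimorphisms of compact Hausdorff spaces are surjective: a point outside of the image is
separated from it by a map to the unit interval. -/
theorem surjective_of_epi_compactT2 {X Y : compactT2.{u}.FullSubcategory} (f : X ⟶ Y) [Epi f] :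
    Function.Surjective f.hom := by
  obtain ⟨_, _⟩ := X.property
  obtain ⟨_, _⟩ := Y.property
  intro y
  by_contra hy
  have hf := uniformContinuous_hom f.hom
  obtain ⟨φ, hφ0, hφ1, hφ⟩ := exists_continuous_zero_one_of_isClosed
    (isCompact_range hf.continuous).isClosed (isClosed_singleton (x := y))
    (disjoint_singleton_right.2 hy)
  let I : compactT2.{u}.FullSubcategory :=
    ⟨.of (ULift.{u} (Icc (0 : ℝ) 1)), (inferInstance : CompactSpace (ULift.{u} (Icc (0 : ℝ) 1))),
      (inferInstance : T2Space (ULift.{u} (Icc (0 : ℝ) 1)))⟩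
  let a : Y ⟶ I := mkHom (fun y ↦ ⟨φ y, hφ y⟩)
    (CompactSpace.uniformContinuous_of_continuous
      (continuous_uliftUp.comp (φ.continuous.subtype_mk hφ)))
  let b : Y ⟶ I := mkHom (fun _ ↦ ⟨0, by simp⟩) uniformContinuous_const
  have hab : f ≫ a = f ≫ b := by
    rw [hom_ext_iff]
    funext x
    exact ULift.ext _ _ (Subtype.ext (hφ0 (mem_range_self x)))
  rw [cancel_epi] at hab
  have h0 : φ y = 0 :=
    congrArg (fun t : ULift.{u} (Icc (0 : ℝ) 1) ↦ (t.down : ℝ)) (congrFun (hom_ext_iff.1 hab) y)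
  exact one_ne_zero ((hφ1 rfl).symm.trans h0)

/-- If morphisms to `P` separate the points of a compact Hausdorff space, then its reflection is
bijective, so that it belongs to `P`. -/
theorem mem_of_separating_of_isEpireflectiveIn [P.IsClosedUnderIsomorphisms]
    (hP : IsEpireflectiveIn P compactT2) {X : UniformSpaceCat.{u}} (hX : compactT2 X)
    (hsep : ∀ x y : X, x ≠ y → ∃ Z : UniformSpaceCat.{u}, P Z ∧ ∃ f : X → Z,
      UniformContinuous f ∧ f x ≠ f y) : P X := by
  obtain ⟨Q, η, _, hu⟩ := hP.2.exists_universal_epi ⟨X, hX⟩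
  have hs := surjective_of_epi_compactT2 η
  have hinj : Function.Injective η.hom := by
    intro x y hxy
    by_contra hne
    obtain ⟨Z, hZ, f, hf, hfxy⟩ := hsep x y hne
    obtain ⟨l, hl⟩ := hu ⟨⟨Z, hP.1 Z hZ⟩, hZ⟩ (mkHom f hf)
    refine hfxy ?_
    have h := congrFun (hom_ext_iff.1 hl)
    exact (h x).symm.trans ((congrArg l.hom.hom hxy).trans (h y))
  have hη := uniformContinuous_hom η.hom
  obtain ⟨_, _⟩ := hX
  obtain ⟨_, _⟩ := Q.obj.property
  let e : X ≃ Q.obj.obj := Equiv.ofBijective _ ⟨hinj, hs⟩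
  refine prop_of_uniformEquiv (X := Q.obj.obj) (Y := X)
    { e.symm with
      uniformContinuous_toFun := ?_
      uniformContinuous_invFun := hη } Q.property
  refine uniformContinuous_of_comp_surjective hη.continuous hs ?_
  convert continuous_id (X := X)
  exact funext e.symm_apply_apply

theorem closedUnderProducts_of_isEpireflectiveIn [P.IsClosedUnderIsomorphisms]
    (hP : IsEpireflectiveIn P compactT2) : ClosedUnderProducts P := by
  intro J X hX
  have := fun j ↦ (hP.1 _ (hX j)).1
  have := fun j ↦ (hP.1 _ (hX j)).2
  refine mem_of_separating_of_isEpireflectiveIn hP ⟨(inferInstance : CompactSpace (∀ j, X j)),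
    (inferInstance : T2Space (∀ j, X j))⟩ fun x y hxy ↦ ?_
  obtain ⟨j, hj⟩ := Function.ne_iff.1 hxy
  exact ⟨X j, hX j, fun z ↦ z j, Pi.uniformContinuous_proj _ j, hj⟩

theorem closedUnderClosedSubspaces_of_isEpireflectiveIn [P.IsClosedUnderIsomorphisms]
    (hP : IsEpireflectiveIn P compactT2) : ClosedUnderClosedSubspaces P := by
  intro D C m hm hr hC
  obtain ⟨_, _⟩ := hP.1 _ hC
  have hc : IsClosedEmbedding m := ⟨hm.isEmbedding, hr⟩
  exact mem_of_separating_of_isEpireflectiveIn hP ⟨hc.compactSpace, hm.isEmbedding.t2Space⟩ fun x y hxy ↦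
    ⟨C, hC, m, uniformContinuous_hom m, hm.injective.ne hxy⟩

/-! ### The equivalence -/

/-- The case distinction is whether all members of `P` are separated. -/
theorem closed_and_algebraic_iff (P : ObjectProperty UniformSpaceCat.{u}) [P.IsClosedUnderIsomorphisms] :
    (ClosedUnderProducts P ∧ ClosedUnderClosedSubspaces P ∧ IsAlgebraicCategory (underlying P)) ↔
      (P = indiscrete ∨ IsEpireflectiveIn P compactT2) := by
  constructor
  · rintro ⟨hprod, hclosed, halg⟩
    by_cases h : ∀ X : UniformSpaceCat.{u}, P X → T0Space X
    · refine Or.inr (isEpireflectiveIn_compactT2 (fun X hX ↦ ?_) hprod hclosed)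
      have := h X hX
      exact ⟨compactSpace_of_isAlgebraicCategory hprod hclosed halg hX, inferInstance⟩
    · push Not at h
      obtain ⟨X, hX, hX'⟩ := h
      exact Or.inl (eq_indiscrete_of_not_t0Space hprod hclosed halg hX hX')
  · rintro (rfl | h)
    · exact ⟨closedUnderProducts_indiscrete, closedUnderClosedSubspaces_indiscrete,
        isAlgebraicCategory_indiscrete⟩
    · have hprod := closedUnderProducts_of_isEpireflectiveIn h
      have hclosed : ClosedUnderClosedSubspaces P := closedUnderClosedSubspaces_of_isEpireflectiveIn h
      exact ⟨hprod, hclosed, isAlgebraicCategory_of_le_compactT2 h.1 hprod hclosed⟩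

/-! ### Independence of the three properties -/

/-- Discrete uniform spaces: the diagonal is an entourage. -/
def discrete : ObjectProperty UniformSpaceCat.{u} :=
  fun X ↦ DiscreteUniformity X

/-- Uniform spaces with exactly one point. -/
def onePoint : ObjectProperty UniformSpaceCat.{u} :=
  fun X ↦ Nonempty X ∧ Subsingleton X

theorem nonempty_uniformEquiv_of_iso {X Y : UniformSpaceCat.{u}} (e : X ≅ Y) :
    Nonempty (X ≃ᵤ Y) :=
  ⟨{ toFun := e.hom
     invFun := e.inv
     left_inv := fun x ↦ congrFun (congrArg (fun f : X ⟶ X ↦ (f : X → X)) e.hom_inv_id) x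
     right_inv := fun y ↦ congrFun (congrArg (fun f : Y ⟶ Y ↦ (f : Y → Y)) e.inv_hom_id) y
     uniformContinuous_toFun := uniformContinuous_hom e.hom
     uniformContinuous_invFun := uniformContinuous_hom e.inv }⟩

theorem discrete_of_injective {X Y : Type*} [UniformSpace X] [UniformSpace Y]
    [DiscreteUniformity Y] {f : X → Y} (hf : UniformContinuous f) (hinj : Function.Injective f) :
    DiscreteUniformity X := by
  rw [discreteUniformity_iff_setRelId_mem_uniformity]
  filter_upwards [hf (DiscreteUniformity.relId_mem_uniformity Y)] with p hp
  exact hinj hp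

theorem isClosedUnderIsomorphisms_discrete : discrete.{u}.IsClosedUnderIsomorphisms where
  of_iso e h := by
    obtain ⟨g⟩ := nonempty_uniformEquiv_of_iso e
    have : DiscreteUniformity _ := h
    exact discrete_of_injective g.symm.uniformContinuous g.symm.injective

theorem isClosedUnderIsomorphisms_onePoint : onePoint.{u}.IsClosedUnderIsomorphisms where
  of_iso e h := by
    obtain ⟨g⟩ := nonempty_uniformEquiv_of_iso e
    exact ⟨h.1.map g, have := h.2; g.symm.toEquiv.subsingleton⟩

theorem closedUnderClosedSubspaces_discrete : ClosedUnderClosedSubspaces discrete.{u} := by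
  intro D C m hm _ hC
  have : DiscreteUniformity C := hC
  exact discrete_of_injective hm.uniformContinuous hm.injective

theorem isAlgebraicCategory_discrete : IsAlgebraicCategory (underlying discrete.{u}) := by
  have huc : ∀ {X : UniformSpaceCat.{u}} {Z : Type u} [UniformSpace Z], discrete X →
      ∀ f : X → Z, UniformContinuous f := fun {X} _ _ hX f ↦
    have : DiscreteUniformity X := hX
    DiscreteUniformity.uniformContinuous X f
  refine isAlgebraicCategory_of_elementary (fun B hB R ↦ ?_) (fun S ↦ ?_)
    (fun _ _ _ _ hB _ _ _ _ l _ ↦ huc hB l)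
  · let _ : UniformSpace (Quot R) := ⊥
    have hQ : discrete (.of (Quot R)) := ⟨rfl⟩
    exact ⟨.of (Quot R), hQ, Quot.mk R, huc hB _, Quot.mk_surjective, fun a b ↦ Quot.sound,
      fun Z hZ k _ hk ↦ ⟨Quot.lift k hk, huc hQ _, rfl⟩⟩
  · let _ : UniformSpace S := ⊥
    have hS : discrete (.of S) := ⟨rfl⟩
    exact ⟨.of S, hS, id, fun Z hZ k ↦ ⟨k, ⟨huc hS k, rfl⟩, fun l hl ↦ hl.2⟩⟩

theorem closedUnderProducts_onePoint : ClosedUnderProducts onePoint.{u} := by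
  intro J X hX
  have := fun j ↦ (hX j).1
  have := fun j ↦ (hX j).2
  exact ⟨(inferInstance : Nonempty (∀ j, X j)), (inferInstance : Subsingleton (∀ j, X j))⟩

theorem isAlgebraicCategory_onePoint : IsAlgebraicCategory (underlying onePoint.{u}) := by
  have hpt : onePoint (.of PUnit.{u + 1}) :=
    ⟨(inferInstance : Nonempty PUnit), (inferInstance : Subsingleton PUnit)⟩
  refine isAlgebraicCategory_of_elementary (fun B hB R ↦ ?_) (fun S ↦ ?_)
    (fun A B Z hA hB hZ h hh hs l _ ↦ ?_)
  · have := hB.2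
    exact ⟨B, hB, id, uniformContinuous_id, Function.surjective_id,
      fun a b _ ↦ Subsingleton.elim a b, fun Z _ k hk _ ↦ ⟨k, hk, rfl⟩⟩
  · refine ⟨.of PUnit, hpt, fun _ ↦ PUnit.unit, fun Z hZ k ↦ ?_⟩
    obtain ⟨⟨z⟩, _⟩ := hZ
    exact ⟨fun _ ↦ z, ⟨uniformContinuous_const, Subsingleton.elim _ _⟩,
      fun l _ ↦ Subsingleton.elim _ _⟩
  · have := hB.2
    exact uniformContinuous_of_const fun a b ↦ congrArg l (Subsingleton.elim a b)

theorem not_indiscrete_of_nontrivial_of_t0Space (X : UniformSpaceCat.{u}) [Nontrivial X]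
    [T0Space X] : ¬ indiscrete X := by
  intro h
  obtain ⟨x, y, hxy⟩ := exists_pair_ne X
  refine hxy (inseparable_iff_ker_uniformity.2 ?_).eq
  rw [show 𝓤 X = ⊤ from h, ker_top]
  exact mem_univ _

end UniformSubcategory

open UniformSubcategory in
theorem theorem5 :
    (∀ P : ObjectProperty UniformSpaceCat.{u}, P.IsClosedUnderIsomorphisms →
      ((ClosedUnderProducts P ∧ ClosedUnderClosedSubspaces P ∧ IsAlgebraicCategory (underlying P)) ↔
        (P = indiscrete ∨ IsEpireflectiveIn P compactT2))) ∧
    -- closedness under products cannot be omitted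
    (∃ P : ObjectProperty UniformSpaceCat.{u}, P.IsClosedUnderIsomorphisms ∧
      ClosedUnderClosedSubspaces P ∧ IsAlgebraicCategory (underlying P) ∧
      ¬ (P = indiscrete ∨ IsEpireflectiveIn P compactT2)) ∧
    -- closedness under closed subspaces cannot be omitted
    (∃ P : ObjectProperty UniformSpaceCat.{u}, P.IsClosedUnderIsomorphisms ∧
      ClosedUnderProducts P ∧ IsAlgebraicCategory (underlying P) ∧
      ¬ (P = indiscrete ∨ IsEpireflectiveIn P compactT2)) ∧
    -- being algebraic cannot be omitted
    (∃ P : ObjectProperty UniformSpaceCat.{u}, P.IsClosedUnderIsomorphisms ∧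
      ClosedUnderProducts P ∧ ClosedUnderClosedSubspaces P ∧
      ¬ (P = indiscrete ∨ IsEpireflectiveIn P compactT2)) := by
  refine ⟨fun P hP ↦ closed_and_algebraic_iff P, ⟨discrete, isClosedUnderIsomorphisms_discrete,
    closedUnderClosedSubspaces_discrete, isAlgebraicCategory_discrete, ?_⟩,
    ⟨onePoint, isClosedUnderIsomorphisms_onePoint, closedUnderProducts_onePoint,
      isAlgebraicCategory_onePoint, ?_⟩,
    ⟨⊤, ⟨fun _ _ ↦ trivial⟩, fun _ _ _ ↦ trivial, fun _ _ _ _ ↦ trivial, ?_⟩⟩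
  · obtain ⟨X, hX, _⟩ : ∃ X : UniformSpaceCat.{u}, discrete X ∧ Infinite X :=
      ⟨@UniformSpaceCat.of (ULift.{u} ℕ) ⊥, @DiscreteUniformity.mk _ ⊥ rfl,
        inferInstanceAs (Infinite (ULift ℕ))⟩
    have : DiscreteUniformity X := hX
    rintro (h | h)
    · exact not_indiscrete_of_nontrivial_of_t0Space X (h ▸ hX)
    · have := (h.1 X hX).1
      exact not_finite_iff_infinite.2 ‹Infinite X› finite_of_compact_of_discrete
  · intro h
    have := isClosedUnderIsomorphisms_onePoint.{u}
    -- the empty space is a closed subspace of the one-point space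
    have hclosed : ClosedUnderClosedSubspaces onePoint.{u} :=
      ((closed_and_algebraic_iff onePoint).2 h).2.1
    have hE : onePoint (.of (∅ : Set PUnit.{u + 1})) := hclosed.subtype
      ⟨(inferInstance : Nonempty PUnit), (inferInstance : Subsingleton PUnit)⟩ isClosed_empty
    exact hE.1.elim fun x ↦ x.2
  · rintro (h | h)
    · have : T0Space (UniformSpaceCat.of (ULift.{u} Bool)) :=
        inferInstanceAs (T0Space (ULift Bool))
      have : Nontrivial (UniformSpaceCat.of (ULift.{u} Bool)) :=
        inferInstanceAs (Nontrivial (ULift Bool))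
      exact not_indiscrete_of_nontrivial_of_t0Space (.of (ULift.{u} Bool)) (h ▸ trivial)
    · obtain ⟨X, _, hX⟩ : ∃ X : UniformSpaceCat.{u}, Nontrivial X ∧ indiscrete X :=
        ⟨@UniformSpaceCat.of (ULift.{u} Bool) ⊤, inferInstanceAs (Nontrivial (ULift Bool)),
          @top_uniformity _⟩
      have := (h.1 X trivial).2
      exact not_indiscrete_of_nontrivial_of_t0Space X hX
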